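/- **Setting.** A branching Markov decision process (BMDP) consists of a finite set $T$ of types, a finite set $A$ of actions, a partial function $p$ assigning to $(q,a)\in T\times A$ a probability distribution $p(q,a)$ with finite support on the set $T^*$ of finite lists of types, and a cost function $c:T\times A\to(0,\infty)$. Let $A(q)$ be the set of actions $a$ for which $p(q,a)$ is defined; it is assumed that $A(q)\neq\emptyset$ for every $q\in T$. A configuration is a list $\alpha\in T^*$. In a non-empty configuration $\alpha=\alpha_1\cdots\alpha_m$ the controller picks a position $i\le m$ and an action $a\in A(\alpha_i)$; the cost $c(\alpha_i,a)$ is incurred, and the entry $\alpha_i$ is replaced in $\alpha$ by a list $\beta$ drawn from $p(\alpha_i,a)$. Once the empty list is reached the process stays there forever at no cost. A strategy maps each finite path (an initial configuration followed by alternating actions and configurations, all transitions having positive probability) to a probability distribution on the actions possible in its last configuration. A strategy $\sigma$ and an initial configuration $\alpha$ induce a probability measure on runs. Let $\mathrm{ETotal}_N(\alpha,\sigma)$ be the expected cumulative cost of the first $N$ steps, and put $$\mathrm{ETotal}_*(\alpha,\sigma)=\lim_{N\to\infty}\mathrm{ETotal}_N(\alpha,\sigma)\in[0,\infty],\qquad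 \mathrm{ETotal}_*(\alpha)=\inf_\sigma \mathrm{ETotal}_*(\alpha,\sigma).$$ Let $c^*\in[0,\infty]^T$ be the vector with $c^*_q=\mathrm{ETotal}_*(q)$, where $q$ denotes the one-entry configuration. Define $F:[0,\infty]^T\to[0,\infty]^T$ by $$F(x)_q=\min_{a\in A(q)}\Bigl(c(q,a)+\sum_{\alpha\in T^*}p(q,a)(\alpha)\sum_{i\le|\alpha|}x_{\alpha_i}\Bigr)$$ (with $0\cdot\infty=0$), and let $x^0=0$, $x^{k+1}=F(x^k)$. Vectors are ordered componentwise, and $[0,\infty]$ carries its usual topology. **Theorem.** For every such BMDP: (a) $F$ is monotone and continuous, and $0\le x^k\le x^{k+1}$ for all $k\ge0$. (b) $c^*=F(c^*)$. (c) $x^k\le c^*$ for all $k\ge 0$. (d) For all $c'\in[0,\infty]^T$, if $c'=F(c')$, then $c^*\le c'$. (e) $c^*=\lim_{k\to\infty}x^k$. -/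

import Mathlib

open MeasureTheory ProbabilityTheory Filter Topology
open scoped NNReal ENNReal

/-- A branching Markov decision process with set of types `T` and set of actions `A` (both are
assumed finite where this is used). `p` is a partial function (`none` means undefined) whose values
are probability distributions with finite support on the finite lists of types, and `c` is a
positive cost function. -/
structure BMDP (T : Type*) (A : Type*) where
  p : T → A → Option (PMF (List T))
  finite_support : ∀ q a μ, p q a = some μ → μ.support.Finite
  c : T → A → ℝ≥0
  c_pos : ∀ q a, 0 < c q a

namespace BMDP

variable {T A : Type*}

/-- The set `A(q)` of actions available to an entity of type `q`. -/
def avail (B : BMDP T A) (q : T) : Set A := {a | (B.p q a).isSome}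

/-! ### The MDP of configurations

A configuration is a list of types. The action `some (i, a)` performs `a` on the entity at
position `i`, where positions are counted from `0`. In the empty configuration the process stays
forever: there the only possible action is the idle action `none`, which is possible nowhere else
and costs nothing. -/

/-- The distribution of the next configuration; a partial function. -/
noncomputable def prob (B : BMDP T A) : List T → Option (ℕ × A) → Option (PMF (List T))
  | [], none => some (PMF.pure [])
  | _ :: _, none => none
  | α, some (i, a) =>
      (α[i]?).bind fun q =>
        (B.p q a).map fun μ => μ.map fun β => α.take i ++ β ++ α.drop (i + 1)

/-- The probability of moving from `α` to `β` under the action `b` (zero if `b` is not possible). -/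
noncomputable def transProb (B : BMDP T A) (α : List T) (b : Option (ℕ × A)) (β : List T) : ℝ≥0∞ :=
  ((B.prob α b).map fun μ => μ β).getD 0

/-- The set of actions that are possible in the configuration `α`. -/
def enabled (B : BMDP T A) (α : List T) : Set (Option (ℕ × A)) := {b | (B.prob α b).isSome}

/-- The cost of an action in a configuration. -/
def cost (B : BMDP T A) (α : List T) : Option (ℕ × A) → ℝ≥0
  | none => 0
  | some (i, a) => ((α[i]?).map fun q => B.c q a).getD 0

/-! ### Paths and strategies -/

/-- One entry of a path: the action by which a configuration was entered, and the configuration.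
The initial configuration carries the dummy action `none`. -/
@[ext] structure Step (T A : Type*) where
  act : Option (ℕ × A)
  state : List T

instance : MeasurableSpace (Step T A) := ⊤

instance : DiscreteMeasurableSpace (Step T A) := ⟨fun _ => trivial⟩

instance [Finite T] [Finite A] : Countable (Step T A) :=
  Function.Injective.countable (f := fun s : Step T A => (s.act, s.state))
    (fun s t h => by cases s; cases t; simp_all)

/-- Sequences `(·, α⁰), (b₁, α¹), …, (bₙ, αⁿ)` of `n` actions and `n + 1` configurations. -/
abbrev Hist (T A : Type*) (n : ℕ) : Type _ := (i : Finset.Iic n) → Step T A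

/-- The `j`-th entry of a history. -/
def Hist.entry {n : ℕ} (π : Hist T A n) (j : ℕ) (hj : j ≤ n) : Step T A :=
  π ⟨j, Finset.mem_Iic.2 hj⟩

/-- The last configuration of a history. -/
def Hist.last {n : ℕ} (π : Hist T A n) : List T := (π.entry n le_rfl).state

/-- `π` is a finite path: each of its transitions has positive probability. -/
def IsPath (B : BMDP T A) {n : ℕ} (π : Hist T A n) : Prop :=
  (π.entry 0 (Nat.zero_le n)).act = none ∧
    ∀ (j : ℕ) (hj : j < n),
      0 < B.transProb (π.entry j hj.le).state (π.entry (j + 1) hj).act (π.entry (j + 1) hj).state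

/-- A (history-dependent, randomised) strategy: it maps every finite path to a probability
distribution on the actions that are possible in the last configuration of the path. The values on
sequences that are not paths of the process are irrelevant, and nothing is required of them. -/
structure Strategy (B : BMDP T A) where
  choose : ∀ {n : ℕ}, Hist T A n → PMF (Option (ℕ × A))
  support_subset : ∀ {n : ℕ} (π : Hist T A n), B.IsPath π → (choose π).support ⊆ B.enabled π.last

/-- The distribution of the next action and configuration after the history `π`. (The default value
in `getD` concerns only actions that the strategy never chooses on a path.) -/
noncomputable def stepPMF (B : BMDP T A) (σ : B.Strategy) {n : ℕ} (π : Hist T A n) :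
    PMF (Step T A) :=
  (σ.choose π).bind fun b =>
    ((B.prob π.last b).getD (PMF.pure π.last)).map fun β => ⟨b, β⟩

/-- `stepPMF` as a transition kernel. -/
noncomputable def stepKernel [Finite T] [Finite A] (B : BMDP T A) (σ : B.Strategy) (n : ℕ) :
    Kernel (Hist T A n) (Step T A) :=
  Kernel.ofFunOfCountable fun π => (B.stepPMF σ π).toMeasure

instance [Finite T] [Finite A] (B : BMDP T A) (σ : B.Strategy) (n : ℕ) :
    IsMarkovKernel (B.stepKernel σ n) :=
  ⟨fun π => inferInstanceAs (IsProbabilityMeasure (B.stepPMF σ π).toMeasure)⟩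

/-- The probability measure on runs induced by the strategy `σ` and the initial configuration `α`
(by the theorem of Ionescu-Tulcea). -/
noncomputable def runMeasure [Finite T] [Finite A] (B : BMDP T A) (σ : B.Strategy) (α : List T) :
    Measure (ℕ → Step T A) :=
  Kernel.traj (X := fun _ => Step T A) (B.stepKernel σ) 0 fun _ => ⟨none, α⟩

theorem stepPMF_apply (B : BMDP T A) (σ : B.Strategy) {n : ℕ} (π : Hist T A n) (hπ : B.IsPath π)
    (s : Step T A) :
    B.stepPMF σ π s = σ.choose π s.act * B.transProb π.last s.act s.state := by
  classical
  rw [stepPMF, PMF.bind_apply, tsum_eq_single s.act]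
  · by_cases h : σ.choose π s.act = 0
    · simp [h]
    congr 1
    have h2 := σ.support_subset π hπ ((PMF.mem_support_iff _ _).2 h)
    obtain ⟨μ, hμ⟩ := Option.isSome_iff_exists.1 h2
    simp only [hμ, transProb, Option.getD_some, Option.map_some]
    rw [PMF.map_apply, tsum_eq_single s.state]
    · simp
    · intro b hb
      rw [if_neg]; intro h; exact hb (by rw [h])
  · intro b hb
    rw [PMF.map_apply, ENNReal.tsum_eq_zero.2, mul_zero]
    intro i; rw [if_neg]; intro h; exact hb (by rw [h])

/-- The measure of the set of runs that extend a given finite path `π` is the product of the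
probabilities of the choices and of the transitions along `π`. -/
theorem runMeasure_cylinder [Finite T] [Finite A] (B : BMDP T A) (σ : B.Strategy) (α : List T)
    {n : ℕ} (π : ℕ → Step T A) (hπ : B.IsPath (Preorder.frestrictLe (π := fun _ : ℕ => Step T A) n π))
    (h0 : (π 0).state = α) :
    B.runMeasure σ α {ω | ∀ i ≤ n, ω i = π i} =
      ∏ i ∈ Finset.range n, σ.choose (Preorder.frestrictLe (π := fun _ : ℕ => Step T A) i π)
        (π (i + 1)).act * B.transProb (π i).state (π (i + 1)).act (π (i + 1)).state := by
  have hpre : ∀ n, {ω : ℕ → Step T A | ∀ i ≤ n, ω i = π i} =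
      Preorder.frestrictLe (π := fun _ : ℕ => Step T A) n ⁻¹' {Preorder.frestrictLe (π := fun _ : ℕ => Step T A) n π} := by
    intro n; ext ω
    simp [funext_iff]
  have hm : ∀ n, Measurable (Preorder.frestrictLe (π := fun _ : ℕ => Step T A) n) :=
    fun n => Preorder.measurable_frestrictLe n
  induction n with
  | zero =>
    have hs : (fun _ => ⟨none, α⟩ : (i : Finset.Iic 0) → Step T A) = Preorder.frestrictLe (π := fun _ : ℕ => Step T A) 0 π := by
      funext ⟨i, hi⟩
      obtain rfl : i = 0 := by simpa using hi
      exact Step.ext hπ.1.symm h0.symm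
    rw [hpre, ← Measure.map_apply (hm 0) (MeasurableSet.of_discrete), runMeasure,
      Kernel.traj_map_frestrictLe_apply, Kernel.partialTraj_self, hs]
    simp [Kernel.id_apply]
  | succ n ih =>
    have hp : B.IsPath (Preorder.frestrictLe (π := fun _ : ℕ => Step T A) n π) :=
      ⟨hπ.1, fun j hj => hπ.2 j (by omega)⟩
    have hd := Kernel.partialTraj_compProd_eq_map_traj
      (X := fun _ => Step T A) (κ := B.stepKernel σ) (Nat.zero_le n)
      (x₀ := fun _ => ⟨none, α⟩)
    have h := congrArg (fun ν => ν ({Preorder.frestrictLe (π := fun _ : ℕ => Step T A) n π} ×ˢ {π (n+1)})) hd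
    rw [Measure.compProd_apply_prod (.of_discrete) (.of_discrete),
      Measure.map_apply (by fun_prop) (MeasurableSet.prod (.of_discrete) (.of_discrete)),
      lintegral_singleton, ← Kernel.traj_map_frestrictLe_apply,
      Measure.map_apply (hm n) (.of_discrete), ← hpre] at h
    rw [Finset.prod_range_succ, ← ih hp]
    have h1 : B.stepKernel σ n (Preorder.frestrictLe (π := fun _ : ℕ => Step T A) n π) {π (n+1)} =
        σ.choose (Preorder.frestrictLe (π := fun _ : ℕ => Step T A) n π) (π (n+1)).act *
          B.transProb (π n).state (π (n+1)).act (π (n+1)).state := by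
      change (B.stepPMF σ _).toMeasure _ = _
      rw [PMF.toMeasure_apply_singleton _ _ (.of_discrete), B.stepPMF_apply σ _ hp]
      rfl
    rw [h1] at h
    rw [mul_comm] at h
    refine Eq.trans ?_ h.symm
    rw [runMeasure]
    congr 1
    ext ω
    simp [funext_iff, Nat.le_succ_iff, or_imp, forall_and]

/-! ### Expected total cost -/

/-- The cumulative cost of a run after `N` steps. -/
noncomputable def total (B : BMDP T A) (N : ℕ) (ω : ℕ → Step T A) : ℝ≥0∞ :=
  ∑ i ∈ Finset.range N, (B.cost (ω i).state (ω (i + 1)).act : ℝ≥0∞)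

/-- The `N`-step expected total cost. -/
noncomputable def eTotalN [Finite T] [Finite A] (B : BMDP T A) (N : ℕ) (α : List T)
    (σ : B.Strategy) : ℝ≥0∞ :=
  ∫⁻ ω, B.total N ω ∂(B.runMeasure σ α)

/-- The expected total cost: the limit of the nondecreasing sequence of the `N`-step expected total
costs, see `tendsto_eTotalN`. -/
noncomputable def eTotal [Finite T] [Finite A] (B : BMDP T A) (α : List T) (σ : B.Strategy) :
    ℝ≥0∞ :=
  ⨆ N, B.eTotalN N α σ

theorem tendsto_eTotalN [Finite T] [Finite A] (B : BMDP T A) (α : List T) (σ : B.Strategy) :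
    Tendsto (fun N => B.eTotalN N α σ) atTop (𝓝 (B.eTotal α σ)) :=
  tendsto_atTop_iSup fun _ _ h => lintegral_mono fun _ =>
    Finset.sum_le_sum_of_subset (Finset.range_mono h)

/-- The optimal expected total cost from the configuration `α`. -/
noncomputable def optTotal [Finite T] [Finite A] (B : BMDP T A) (α : List T) : ℝ≥0∞ :=
  ⨅ σ : B.Strategy, B.eTotal α σ

/-- The vector `c*` of the optimal expected total costs from a single entity. -/
noncomputable def cstar [Finite T] [Finite A] (B : BMDP T A) : T → ℝ≥0∞ :=
  fun q => B.optTotal [q]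

/-! ### The Bellman operator -/

/-- `F(x)_q = min_{a ∈ A(q)} (c(q,a) + ∑_α p(q,a)(α) ∑_i x_{α_i})`. -/
noncomputable def bellman (B : BMDP T A) (x : T → ℝ≥0∞) : T → ℝ≥0∞ := fun q =>
  ⨅ a : B.avail q,
    ((B.c q a : ℝ≥0∞) + ∑' α : List T, (B.p q a).get a.2 α * (α.map x).sum)

end BMDP

/-! Everything reduces to `c* = ⨆ k, x^k`. Since `F` is monotone and continuous, this supremum is a
fixed point and the limit of the iterates, so it suffices that `c*` lies below every fixed point and
above every iterate.

Upper bound (`cstar_le_of_bellman_eq`): at a fixed point `x`, playing a minimizing action on the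
first entity keeps incurred cost plus the `x`-sum of the configuration constant in expectation, so
no `N`-step cost exceeds the initial `x`-sum.

Lower bound (`sum_iterate_bellman_le_contCost`, `iterate_bellman_le_cstar`): a strategy may
interleave entities and leave some untouched within the horizon. Each entity carries a number of
generations still counted, which keeps the value of the untouched ones below a finite bound `R`.
Each step before termination costs at least `δ > 0`, so an `ε`-fraction of the cost pays off `R`
once `N * ε * δ` exceeds it. Then `ε → 0`. -/

namespace PMF

/-! ### Averages with respect to a `PMF` -/

variable {α β : Type*}

theorem tsum_bind_mul (p : PMF α) (f : α → PMF β) (g : β → ℝ≥0∞) :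
    ∑' b, p.bind f b * g b = ∑' a, p a * ∑' b, f a b * g b := by
  simp_rw [PMF.bind_apply, ← ENNReal.tsum_mul_right]
  rw [ENNReal.tsum_comm]
  simp_rw [← ENNReal.tsum_mul_left, mul_assoc]

theorem tsum_pure_mul (a : α) (g : α → ℝ≥0∞) : ∑' b, PMF.pure a b * g b = g a := by
  classical
  rw [tsum_eq_single a (fun b hb => by simp [hb])]
  simp

theorem tsum_map_mul (p : PMF α) (f : α → β) (g : β → ℝ≥0∞) :
    ∑' b, p.map f b * g b = ∑' a, p a * g (f a) := by
  rw [PMF.map, tsum_bind_mul]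
  simp only [Function.comp_apply, tsum_pure_mul]

theorem tsum_mul_const (p : PMF α) (x : ℝ≥0∞) : ∑' a, p a * x = x := by
  rw [ENNReal.tsum_mul_right, p.tsum_coe, one_mul]

/-- Total mass one lets constants move under the average, so that two expected values can be
compared outcome by outcome. -/
theorem tsum_mul_affine (p : PMF α) (u v : ℝ≥0∞) (g : α → ℝ≥0∞) :
    ∑' a, p a * (u * g a + v) = u * ∑' a, p a * g a + v := by
  simp_rw [mul_add, ENNReal.tsum_add, tsum_mul_const, ← ENNReal.tsum_mul_left, mul_left_comm]

/-- An average of values bounded by `x` on the support is bounded by `x`. -/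
theorem tsum_mul_le (p : PMF α) {g : α → ℝ≥0∞} {x : ℝ≥0∞} (h : ∀ a, p a ≠ 0 → g a ≤ x) :
    ∑' a, p a * g a ≤ x := by
  refine le_trans (ENNReal.tsum_le_tsum fun a => ?_) (p.tsum_mul_const x).le
  by_cases ha : p a = 0
  · simp [ha]
  · exact mul_le_mul_right (h a ha) _

/-- An average of values bounded below by `x` on the support is bounded below by `x`. -/
theorem le_tsum_mul (p : PMF α) {g : α → ℝ≥0∞} {x : ℝ≥0∞} (h : ∀ a, p a ≠ 0 → x ≤ g a) :
    x ≤ ∑' a, p a * g a := by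
  refine le_trans (p.tsum_mul_const x).ge (ENNReal.tsum_le_tsum fun a => ?_)
  by_cases ha : p a = 0
  · simp [ha]
  · exact mul_le_mul_right (h a ha) _

theorem lintegral_toMeasure [Countable α] [MeasurableSpace α] [DiscreteMeasurableSpace α]
    (p : PMF α) (g : α → ℝ≥0∞) : ∫⁻ a, g a ∂p.toMeasure = ∑' a, p a * g a := by
  rw [lintegral_countable']
  simp_rw [PMF.toMeasure_apply_singleton _ _ (MeasurableSet.of_discrete), mul_comm]

end PMF

namespace BMDP

variable {T A : Type*}

/-! ### The Bellman operator -/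

theorem bellman_le (B : BMDP T A) (x : T → ℝ≥0∞) {q : T} {a : A} {μ : PMF (List T)}
    (h : B.p q a = some μ) :
    B.bellman x q ≤ B.c q a + ∑' α : List T, μ α * (α.map x).sum := by
  have ha : a ∈ B.avail q := by simp [avail, h]
  refine (iInf_le _ ⟨a, ha⟩).trans (le_of_eq ?_)
  simp [h]

theorem exists_bellman_eq [Finite A] (B : BMDP T A) (x : T → ℝ≥0∞) {q : T}
    (hq : (B.avail q).Nonempty) :
    ∃ a μ, B.p q a = some μ ∧
      B.bellman x q = B.c q a + ∑' α : List T, μ α * (α.map x).sum := by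
  have := hq.to_subtype
  obtain ⟨⟨a, ha⟩, h⟩ := exists_eq_ciInf_of_finite (f := fun a : B.avail q =>
    ((B.c q a : ℝ≥0∞) + ∑' α : List T, (B.p q a).get a.2 α * (α.map x).sum))
  exact ⟨a, (B.p q a).get ha, (Option.some_get ha).symm, h.symm⟩

theorem sum_map_mono {x y : T → ℝ≥0∞} (h : x ≤ y) (α : List T) :
    (α.map x).sum ≤ (α.map y).sum :=
  List.sum_le_sum fun q _ => h q

theorem bellman_mono (B : BMDP T A) : Monotone B.bellman := by
  intro x y h q
  refine iInf_mono fun a => add_le_add_right (ENNReal.tsum_le_tsum fun α => ?_) _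
  exact mul_le_mul_right (sum_map_mono h α) _

/-- Finite support makes each average a finite sum, its weights are finite, so multiplying by them
is continuous even at `∞`, and the minimum is over finitely many actions. -/
theorem bellman_continuous [Finite A] (B : BMDP T A) : Continuous B.bellman := by
  refine continuous_pi fun q => ?_
  have := Fintype.ofFinite (B.avail q)
  have hc : ∀ a : B.avail q, Continuous fun x : T → ℝ≥0∞ =>
      (B.c q a : ℝ≥0∞) + ∑' α : List T, (B.p q a).get a.2 α * (α.map x).sum := by
    intro a
    have hf := B.finite_support q a _ (Option.some_get a.2).symm
    refine (continuous_const_add (B.c q a : ℝ≥0∞)).comp ?_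
    have : ∀ x : T → ℝ≥0∞, ∑' α : List T, (B.p q a).get a.2 α * (α.map x).sum =
        ∑ α ∈ hf.toFinset, (B.p q a).get a.2 α * (α.map x).sum := by
      intro x
      refine tsum_eq_sum fun α hα => ?_
      have : (B.p q a).get a.2 α = 0 := by simpa using hα
      simp [this]
    simp_rw [this]
    refine continuous_finsetSum _ fun α _ => ?_
    refine (ENNReal.continuous_const_mul (PMF.apply_ne_top _ _)).comp ?_
    exact continuous_list_sum (X := T → ℝ≥0∞) (f := fun q x => x q) α fun q _ => continuous_apply q
  have := Continuous.finset_inf (s := Finset.univ) fun a _ => hc a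
  convert this using 1
  ext x
  rw [Finset.inf_univ_eq_iInf, iInf_apply]
  rfl

theorem monotone_iterate_bellman (B : BMDP T A) : Monotone fun k : ℕ => B.bellman^[k] 0 :=
  B.bellman_mono.monotone_iterate_of_le_map fun _ => zero_le

theorem tendsto_iterate_bellman (B : BMDP T A) :
    Tendsto (fun k : ℕ => B.bellman^[k] 0) atTop (𝓝 (⨆ k : ℕ, B.bellman^[k] 0)) :=
  tendsto_atTop_iSup B.monotone_iterate_bellman

theorem bellman_iSup_iterate [Finite A] (B : BMDP T A) :
    B.bellman (⨆ k : ℕ, B.bellman^[k] 0) = ⨆ k : ℕ, B.bellman^[k] 0 :=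
  isFixedPt_of_tendsto_iterate B.tendsto_iterate_bellman B.bellman_continuous.continuousAt

/-! ### The expected cost after a history -/

/-- The history `π` followed by one more step. -/
def Hist.snoc {n : ℕ} (π : Hist T A n) (s : Step T A) : Hist T A (n + 1) :=
  fun i => if h : (i : ℕ) ≤ n then π.entry i h else s

theorem Hist.snoc_entry {n : ℕ} (π : Hist T A n) (s : Step T A) {j : ℕ} (hj : j ≤ n) :
    (π.snoc s).entry j (hj.trans n.le_succ) = π.entry j hj := by
  simp [Hist.snoc, Hist.entry, hj]

theorem Hist.snoc_entry_last {n : ℕ} (π : Hist T A n) (s : Step T A) :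
    (π.snoc s).entry (n + 1) le_rfl = s := by
  simp [Hist.snoc, Hist.entry]

theorem Hist.last_snoc {n : ℕ} (π : Hist T A n) (s : Step T A) :
    (π.snoc s).last = s.state := by
  rw [Hist.last, Hist.snoc_entry_last]

theorem IsPath.snoc {B : BMDP T A} {n : ℕ} {π : Hist T A n} (hπ : B.IsPath π) {s : Step T A}
    (hs : 0 < B.transProb π.last s.act s.state) : B.IsPath (π.snoc s) := by
  refine ⟨?_, fun j hj => ?_⟩
  · rw [Hist.snoc_entry _ _ (Nat.zero_le n)]
    exact hπ.1
  · rw [Hist.snoc_entry _ _ (Nat.lt_succ_iff.1 hj)]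
    rcases (Nat.lt_succ_iff.1 hj).lt_or_eq with h | rfl
    · rw [Hist.snoc_entry _ _ h]
      exact hπ.2 j h
    · rw [Hist.snoc_entry_last]
      exact hs

/-- The initial history of the configuration `α`. -/
def Hist.init (α : List T) : Hist T A 0 := fun _ => ⟨none, α⟩

theorem isPath_init (B : BMDP T A) (α : List T) : B.IsPath (Hist.init (A := A) α) :=
  ⟨rfl, fun j hj => absurd hj (Nat.not_lt_zero j)⟩

/-- The expected cost of the `N` steps that follow the history `π`. -/
noncomputable def contCost (B : BMDP T A) (σ : B.Strategy) : ℕ → ∀ {n : ℕ}, Hist T A n → ℝ≥0∞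
  | 0, _, _ => 0
  | N + 1, _, π =>
      ∑' s, B.stepPMF σ π s * (B.cost π.last s.act + contCost B σ N (π.snoc s))

/-- The one-step recursion of `contCost`, with the action and the successor drawn one after the
other. -/
theorem contCost_succ (B : BMDP T A) (σ : B.Strategy) (N : ℕ) {n : ℕ} (π : Hist T A n) :
    B.contCost σ (N + 1) π = ∑' b, σ.choose π b *
      ∑' β, ((B.prob π.last b).getD (PMF.pure π.last)) β *
        (B.cost π.last b + B.contCost σ N (π.snoc ⟨b, β⟩)) := by
  rw [contCost, stepPMF, PMF.tsum_bind_mul]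
  simp_rw [PMF.tsum_map_mul]

variable [Finite T] [Finite A]

/-- The joint law of the history up to time `n` and the next step is the composition product of the
history's law with the step kernel. -/
theorem lintegral_frestrictLe_succ (B : BMDP T A) (σ : B.Strategy) (α : List T) (n : ℕ)
    (f : Hist T A n → Step T A → ℝ≥0∞) :
    ∫⁻ ω, f (Preorder.frestrictLe (π := fun _ : ℕ => Step T A) n ω) (ω (n + 1))
        ∂(B.runMeasure σ α) =
      ∫⁻ ω, ∑' s, B.stepPMF σ (Preorder.frestrictLe (π := fun _ : ℕ => Step T A) n ω) s *
        f (Preorder.frestrictLe (π := fun _ : ℕ => Step T A) n ω) s ∂(B.runMeasure σ α) := by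
  have hm : Measurable (Preorder.frestrictLe (π := fun _ : ℕ => Step T A) n) :=
    Preorder.measurable_frestrictLe n
  have hd := Kernel.partialTraj_compProd_eq_map_traj
    (X := fun _ => Step T A) (κ := B.stepKernel σ) (Nat.zero_le n)
    (x₀ := fun _ => ⟨none, α⟩)
  have h1 := congrArg (fun ν => ∫⁻ x, f x.1 x.2 ∂ν) hd
  rw [Measure.lintegral_compProd (.of_discrete), lintegral_map (.of_discrete) (by fun_prop),
    ← Kernel.traj_map_frestrictLe_apply, lintegral_map (.of_discrete) hm] at h1
  rw [runMeasure]
  refine h1.symm.trans (lintegral_congr fun ω => ?_)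
  exact PMF.lintegral_toMeasure _ _

/-- Arbitrary `n` lets the induction on `N` move one step from the future to the past; `n = 0`
replaces the integral over runs by a recursion. -/
theorem eTotalN_add_lintegral_contCost (B : BMDP T A) (σ : B.Strategy) (α : List T) (N n : ℕ) :
    B.eTotalN n α σ + ∫⁻ ω, B.contCost σ N
        (Preorder.frestrictLe (π := fun _ : ℕ => Step T A) n ω) ∂(B.runMeasure σ α) =
      B.eTotalN (n + N) α σ := by
  induction N generalizing n with
  | zero => simp [contCost]
  | succ N ih =>
    rw [show n + (N + 1) = n + 1 + N by omega, ← ih (n + 1)]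
    have hcost : Measurable fun ω : ℕ → Step T A =>
        (B.cost (ω n).state (ω (n + 1)).act : ℝ≥0∞) := by
      have : Measurable fun p : Step T A × Step T A => (B.cost p.1.state p.2.act : ℝ≥0∞) :=
        .of_discrete
      exact this.comp (f := fun ω : ℕ → Step T A => (ω n, ω (n + 1)))
        ((measurable_pi_apply n).prodMk (measurable_pi_apply (n + 1)))
    have hsplit : B.eTotalN (n + 1) α σ = B.eTotalN n α σ +
        ∫⁻ ω, (B.cost (ω n).state (ω (n + 1)).act : ℝ≥0∞) ∂(B.runMeasure σ α) := by
      rw [eTotalN, eTotalN, ← lintegral_add_right _ hcost]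
      simp only [total, Finset.sum_range_succ]
    rw [hsplit, add_assoc, ← lintegral_add_left hcost]
    congr 1
    refine (B.lintegral_frestrictLe_succ σ α n fun π s =>
      (B.cost π.last s.act : ℝ≥0∞) + B.contCost σ N (π.snoc s)).symm.trans ?_
    refine lintegral_congr fun ω => ?_
    congr 2
    -- Appending `ω (n + 1)` to the restriction of `ω` to times up to `n` gives its restriction up
    -- to `n + 1`.
    ext1 ⟨i, hi⟩
    have hi' : i ≤ n + 1 := Finset.mem_Iic.1 hi
    simp only [Hist.snoc, Hist.entry, Preorder.frestrictLe_apply]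
    split_ifs with h
    · rfl
    · obtain rfl : i = n + 1 := by omega
      rfl

theorem eTotalN_eq_contCost (B : BMDP T A) (σ : B.Strategy) (α : List T) (N : ℕ) :
    B.eTotalN N α σ = B.contCost σ N (Hist.init (A := A) α) := by
  have h := B.eTotalN_add_lintegral_contCost σ α N 0
  have h0 : B.eTotalN 0 α σ = 0 := by simp [eTotalN, total]
  rw [h0, zero_add, zero_add] at h
  have hm : Measurable (Preorder.frestrictLe (π := fun _ : ℕ => Step T A) 0) :=
    Preorder.measurable_frestrictLe 0
  rw [← h, ← lintegral_map (f := B.contCost σ N) (.of_discrete) hm, runMeasure,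
    Kernel.traj_map_frestrictLe_apply, Kernel.partialTraj_self, Kernel.id_apply,
    lintegral_dirac]
  rfl

end BMDP

/-! ### Acting on one entity of a configuration -/

theorem List.sum_map_take_add_drop {ι : Type*} (f : ι → ℝ≥0∞) {l : List ι} {i : ℕ} {x : ι}
    (h : l[i]? = some x) :
    (l.map f).sum = ((l.take i).map f).sum + f x + ((l.drop (i + 1)).map f).sum := by
  obtain ⟨hi, rfl⟩ := List.getElem?_eq_some_iff.1 h
  conv_lhs => rw [← List.take_append_drop i l, List.drop_eq_getElem_cons hi]
  rw [List.map_append, List.sum_append, List.map_cons, List.sum_cons, add_assoc]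

namespace BMDP

variable {T A : Type*}

theorem prob_some (B : BMDP T A) {α : List T} {i : ℕ} {a : A} {q : T} {μ : PMF (List T)}
    (hq : α[i]? = some q) (hμ : B.p q a = some μ) :
    B.prob α (some (i, a)) = some (μ.map fun β => α.take i ++ β ++ α.drop (i + 1)) := by
  simp [prob, hq, hμ]

theorem cost_some (B : BMDP T A) {α : List T} {i : ℕ} {a : A} {q : T} (hq : α[i]? = some q) :
    B.cost α (some (i, a)) = B.c q a := by
  rw [cost, hq]
  rfl

theorem exists_of_mem_enabled (B : BMDP T A) {α : List T} (hα : α ≠ []) {b : Option (ℕ × A)}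
    (hb : b ∈ B.enabled α) :
    ∃ i a q μ, b = some (i, a) ∧ α[i]? = some q ∧ B.p q a = some μ := by
  match α, b with
  | [], _ => exact absurd rfl hα
  | _ :: _, none => simp [enabled, prob] at hb
  | r :: α, some (i, a) =>
    obtain ⟨ν, hν⟩ := Option.isSome_iff_exists.1 hb
    simp only [prob, Option.bind_eq_some_iff, Option.map_eq_some_iff] at hν
    obtain ⟨q, hq, μ, hμ, -⟩ := hν
    exact ⟨i, a, q, μ, rfl, hq, hμ⟩

/-! ### Bounds for the data of the process -/

theorem exists_length_le [Finite T] [Finite A] (B : BMDP T A) :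
    ∃ m : ℕ, ∀ q a μ, B.p q a = some μ → ∀ β : List T, μ β ≠ 0 → β.length ≤ m := by
  have hfin : (⋃ z : T × A, {β : List T | ∃ μ, B.p z.1 z.2 = some μ ∧ μ β ≠ 0}).Finite := by
    refine Set.finite_iUnion fun z => ?_
    cases h : B.p z.1 z.2 with
    | none => simp
    | some μ =>
      refine (B.finite_support _ _ _ h).subset ?_
      rintro β ⟨ν, hν, hβ⟩
      obtain rfl := Option.some.inj hν
      exact hβ
  obtain ⟨m, hm⟩ := (hfin.image List.length).bddAbove
  refine ⟨m, fun q a μ hμ β hβ => hm ⟨β, Set.mem_iUnion.2 ⟨(q, a), μ, hμ, hβ⟩, rfl⟩⟩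

theorem exists_cost_le [Finite T] [Finite A] (B : BMDP T A) : ∃ C : ℝ≥0, ∀ q a, B.c q a ≤ C := by
  obtain ⟨C, hC⟩ := (Set.finite_range fun z : T × A => B.c z.1 z.2).bddAbove
  exact ⟨C, fun q a => hC ⟨(q, a), rfl⟩⟩

theorem exists_pos_le_cost [Finite T] [Finite A] (B : BMDP T A) :
    ∃ δ : ℝ≥0, 0 < δ ∧ ∀ q a, δ ≤ B.c q a := by
  cases isEmpty_or_nonempty (T × A) with
  | inl h => exact ⟨1, one_pos, fun q a => h.elim (q, a)⟩
  | inr h =>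
    obtain ⟨z, hz⟩ := Finite.exists_min fun z : T × A => B.c z.1 z.2
    exact ⟨_, B.c_pos z.1 z.2, fun q a => hz (q, a)⟩

/-- A bound for the cost of the first `k` generations of the progeny of an entity, if each action
costs at most `C` and creates at most `m` entities. -/
noncomputable def generationBound (C : ℝ≥0) (m : ℕ) : ℕ → ℝ≥0∞
  | 0 => 0
  | k + 1 => C + m * generationBound C m k

theorem generationBound_ne_top (C : ℝ≥0) (m k : ℕ) : generationBound C m k ≠ ⊤ := by
  induction k with
  | zero => simp [generationBound]
  | succ k ih =>
    exact ENNReal.add_ne_top.2 ⟨ENNReal.coe_ne_top, ENNReal.mul_ne_top (ENNReal.natCast_ne_top m) ih⟩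

/-- Replacing an entity labelled `k` by at most `m` entities labelled `k - 1` does not raise the sum
of the bounds, so one `R` serves along the whole path. -/
theorem mul_generationBound_pred_le (C : ℝ≥0) (m k : ℕ) :
    m * generationBound C m (k - 1) ≤ generationBound C m k := by
  cases k with
  | zero => simp [generationBound]
  | succ k => exact le_add_self

theorem sum_map_const_le {x : ℝ≥0∞} {m : ℕ} {β : List T} (hβ : β.length ≤ m) :
    (β.map fun _ => x).sum ≤ m * x := by
  rw [List.map_const', List.sum_replicate, nsmul_eq_mul]
  exact mul_le_mul_left (Nat.cast_le.2 hβ) _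

/-- With truncated subtraction the bound also covers `k = 0`, where the left side vanishes, so
exhausted labels need no separate case. -/
theorem iterate_bellman_le (B : BMDP T A) (k : ℕ) {q : T} {a : A} {μ : PMF (List T)}
    (h : B.p q a = some μ) :
    B.bellman^[k] 0 q ≤ B.c q a + ∑' α : List T, μ α * (α.map (B.bellman^[k - 1] 0)).sum := by
  cases k with
  | zero => simp
  | succ k =>
    rw [Function.iterate_succ_apply']
    exact B.bellman_le _ h

theorem iterate_bellman_le_generationBound (B : BMDP T A) (hA : ∀ q : T, (B.avail q).Nonempty)
    {C : ℝ≥0} (hC : ∀ q a, B.c q a ≤ C) {m : ℕ}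
    (hm : ∀ q a μ, B.p q a = some μ → ∀ β : List T, μ β ≠ 0 → β.length ≤ m) (k : ℕ) (q : T) :
    B.bellman^[k] 0 q ≤ generationBound C m k := by
  induction k generalizing q with
  | zero => simp
  | succ k ih =>
    obtain ⟨a, ha⟩ := hA q
    obtain ⟨μ, hμ⟩ := Option.isSome_iff_exists.1 ha
    refine (B.iterate_bellman_le (k + 1) hμ).trans ?_
    refine add_le_add (ENNReal.coe_le_coe.2 (hC q a)) (μ.tsum_mul_le fun β hβ => ?_)
    exact (sum_map_mono (fun q => ih q) β).trans (sum_map_const_le (hm q a μ hμ β hβ))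

/-! ### The lower bound

Each entity of a configuration is given a label `k`, the number of generations of its progeny whose
cost is still taken into account; the entities created by an action get the label of their parent,
decreased by one. -/

/-- The total cost of a labelled configuration is bounded below by the sum of the iterates of the
Bellman operator, up to an error that vanishes for a long horizon: while the process has not
terminated, each step costs at least `δ`. -/
theorem sum_iterate_bellman_le_contCost (B : BMDP T A) (hA : ∀ q : T, (B.avail q).Nonempty)
    {C : ℝ≥0} (hC : ∀ q a, B.c q a ≤ C) {m : ℕ}
    (hm : ∀ q a μ, B.p q a = some μ → ∀ β : List T, μ β ≠ 0 → β.length ≤ m)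
    {δ : ℝ≥0} (hδ : ∀ q a, δ ≤ B.c q a) (σ : B.Strategy) (ε : ℝ≥0) (R : ℝ≥0∞) (N : ℕ) {n : ℕ}
    (π : Hist T A n) (hπ : B.IsPath π) (L : List (T × ℕ)) (hL : L.map Prod.fst = π.last)
    (hR : (L.map fun e => generationBound C m e.2).sum ≤ R) :
    (L.map fun e => B.bellman^[e.2] 0 e.1).sum ≤
      (1 + ε) * B.contCost σ N π + (R - N * (ε * δ)) := by
  induction N generalizing n L with
  | zero =>
    -- With no steps left, the whole counted value is charged to `R`.
    refine le_trans (List.sum_le_sum fun e _ => ?_) (hR.trans (by simp))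
    exact B.iterate_bellman_le_generationBound hA hC hm e.2 e.1
  | succ N ih =>
    rcases eq_or_ne L [] with rfl | hne
    · simp
    have hlast : π.last ≠ [] := by
      rw [← hL]
      simpa using hne
    -- With the factor and the error inside the average, it suffices to treat each action chosen
    -- with positive probability.
    rw [contCost_succ, ← PMF.tsum_mul_affine]
    refine PMF.le_tsum_mul _ fun b hb => ?_
    have hben := σ.support_subset π hπ ((PMF.mem_support_iff _ _).2 hb)
    obtain ⟨i, a, q, μ, rfl, hq, hμ⟩ := B.exists_of_mem_enabled hlast hben
    have hprob := B.prob_some hq hμ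
    rw [hprob, B.cost_some hq, Option.getD_some, PMF.tsum_map_mul, ← PMF.tsum_mul_affine]
    obtain ⟨⟨q', k⟩, hk, rfl⟩ : ∃ e, L[i]? = some e ∧ e.1 = q := by
      rw [← hL, List.getElem?_map, Option.map_eq_some_iff] at hq
      exact hq
    rw [List.sum_map_take_add_drop _ hk] at hR ⊢
    set S₁ := ((L.take i).map fun e => B.bellman^[e.2] 0 e.1).sum
    set S₂ := ((L.drop (i + 1)).map fun e => B.bellman^[e.2] 0 e.1).sum
    calc S₁ + B.bellman^[k] 0 q' + S₂
        ≤ S₁ + (B.c q' a + ∑' β : List T, μ β * (β.map (B.bellman^[k - 1] 0)).sum) + S₂ := by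
          gcongr
          exact B.iterate_bellman_le k hμ
      _ = ∑' β : List T, μ β *
            (1 * (β.map (B.bellman^[k - 1] 0)).sum + (B.c q' a + S₁ + S₂)) := by
          rw [PMF.tsum_mul_affine, one_mul]
          ring
      _ ≤ _ := by
          refine ENNReal.tsum_le_tsum fun β => ?_
          by_cases hβ : μ β = 0
          · simp [hβ]
          refine mul_le_mul_right ?_ _
          have hpos : 0 < B.transProb π.last (some (i, a))
              (π.last.take i ++ β ++ π.last.drop (i + 1)) := by
            rw [transProb, hprob, Option.map_some, Option.getD_some, pos_iff_ne_zero,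
              ← PMF.mem_support_iff, PMF.mem_support_map_iff]
            exact ⟨β, (PMF.mem_support_iff _ _).2 hβ, rfl⟩
          have key := ih (π.snoc ⟨some (i, a), π.last.take i ++ β ++ π.last.drop (i + 1)⟩)
            (hπ.snoc hpos) (L.take i ++ β.map (fun r => (r, k - 1)) ++ L.drop (i + 1)) (by
              rw [Hist.last_snoc, ← hL]
              simp [List.map_take, List.map_drop, Function.comp_def]) (by
              refine le_trans ?_ hR
              simp only [List.map_append, List.sum_append, List.map_map, Function.comp_def]
              gcongr
              exact (sum_map_const_le (hm _ _ _ hμ β hβ)).trans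
                (mul_generationBound_pred_le C m k))
          simp only [List.map_append, List.sum_append, List.map_map, Function.comp_def] at key
          -- The surplus `ε * c` of this step is at least `ε * δ`, the amount by which the error
          -- must shrink.
          have herr : R - N * (ε * δ) ≤ ε * B.c q' a + (R - (N + 1 : ℕ) * (ε * δ)) := by
            have h1 : ((N + 1 : ℕ) : ℝ≥0∞) * (ε * δ) = N * (ε * δ) + ε * δ := by
              push_cast
              ring
            rw [h1, tsub_add_eq_tsub_tsub]
            refine (le_add_tsub (b := (ε * δ : ℝ≥0∞))).trans ?_
            gcongr
            exact hδ q' a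
          set J := B.contCost σ N
            (π.snoc ⟨some (i, a), π.last.take i ++ β ++ π.last.drop (i + 1)⟩)
          calc 1 * (β.map (B.bellman^[k - 1] 0)).sum + (B.c q' a + S₁ + S₂)
              = B.c q' a + (S₁ + (β.map (B.bellman^[k - 1] 0)).sum + S₂) := by ring
            _ ≤ B.c q' a + ((1 + ε) * J + (R - N * (ε * δ))) := by gcongr
            _ ≤ B.c q' a + ((1 + ε) * J + (ε * B.c q' a + (R - (N + 1 : ℕ) * (ε * δ)))) := by
                gcongr
            _ = (1 + ε) * (B.c q' a + J) + (R - (N + 1 : ℕ) * (ε * δ)) := by ring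

theorem iterate_bellman_le_cstar [Finite T] [Finite A] (B : BMDP T A)
    (hA : ∀ q : T, (B.avail q).Nonempty) (k : ℕ) : B.bellman^[k] 0 ≤ B.cstar := by
  intro q
  refine le_iInf fun σ => ?_
  obtain ⟨C, hC⟩ := B.exists_cost_le
  obtain ⟨m, hm⟩ := B.exists_length_le
  obtain ⟨δ, hδ0, hδ⟩ := B.exists_pos_le_cost
  rcases eq_or_ne (B.eTotal [q] σ) ⊤ with htop | htop
  · rw [htop]
    exact le_top
  have hε : ∀ ε : ℝ≥0, 0 < ε → B.bellman^[k] 0 q ≤ (1 + ε) * B.eTotal [q] σ := by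
    intro ε hε
    have h0 : (ε * δ : ℝ≥0∞) ≠ 0 := by
      simp [hε.ne', hδ0.ne']
    -- A horizon long enough for the error term to vanish.
    obtain ⟨N, hN⟩ := ENNReal.exists_nat_mul_gt h0 (generationBound_ne_top C m k)
    have h := B.sum_iterate_bellman_le_contCost hA hC hm hδ σ ε (generationBound C m k) N
      (Hist.init [q]) (B.isPath_init [q]) [(q, k)] rfl (by simp)
    rw [tsub_eq_zero_of_le hN.le, add_zero, ← eTotalN_eq_contCost] at h
    refine le_trans (by simp) (h.trans (mul_le_mul_right (le_iSup (fun N => B.eTotalN N [q] σ) N) _))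
  have hlim : Tendsto (fun ε : ℝ≥0 => (1 + (ε : ℝ≥0∞)) * B.eTotal [q] σ) (𝓝[>] 0)
      (𝓝 (B.eTotal [q] σ)) := by
    -- Continuity in `ε` uses that the total cost is finite.
    have hc : Continuous fun ε : ℝ≥0 => (1 + (ε : ℝ≥0∞)) * B.eTotal [q] σ :=
      (ENNReal.continuous_mul_const htop).comp (continuous_const.add ENNReal.continuous_coe)
    simpa using (hc.tendsto 0).mono_left nhdsWithin_le_nhds
  exact ge_of_tendsto hlim (eventually_nhdsWithin_of_forall hε)

/-! ### The upper bound -/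

/-- The strategy that always performs the action `f q` on the first entity, where `q` is the type of
that entity. -/
noncomputable def firstStrategy (B : BMDP T A) (f : T → A) (hf : ∀ q, f q ∈ B.avail q) :
    B.Strategy where
  choose π := PMF.pure (π.last.head?.map fun q => (0, f q))
  support_subset π _ := by
    rw [PMF.support_pure, Set.singleton_subset_iff]
    cases h : π.last with
    | nil => simp [enabled, prob]
    | cons q α =>
      obtain ⟨μ, hμ⟩ := Option.isSome_iff_exists.1 (hf q)
      simp [enabled, prob, hμ]

/-- Minimizing actions for `x` define a strategy under which cost plus expected next `x`-sum equals
the current `x`-sum; dropping the nonnegative remainder after `N` steps bounds the cost. -/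
theorem cstar_le_of_bellman_eq [Finite T] [Finite A] (B : BMDP T A)
    (hA : ∀ q : T, (B.avail q).Nonempty) {x : T → ℝ≥0∞} (hx : x = B.bellman x) : B.cstar ≤ x := by
  choose f μ hμ hf using fun q => B.exists_bellman_eq x (hA q)
  have hav : ∀ q, f q ∈ B.avail q := fun q => by simp [avail, hμ q]
  have hchoose : ∀ {n : ℕ} (π : Hist T A n), (B.firstStrategy f hav).choose π =
      PMF.pure (π.last.head?.map fun q => (0, f q)) := fun _ => rfl
  have hcont : ∀ (N : ℕ) {n : ℕ} (π : Hist T A n),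
      B.contCost (B.firstStrategy f hav) N π ≤ (π.last.map x).sum := by
    intro N
    induction N with
    | zero => intro n π; exact zero_le
    | succ N ih =>
      intro n π
      rw [contCost_succ, hchoose, PMF.tsum_pure_mul]
      cases h : π.last with
      | nil =>
        refine PMF.tsum_mul_le _ fun β hβ => ?_
        obtain rfl : β = [] := by simpa [prob] using hβ
        have := ih (π.snoc ⟨none, []⟩)
        rw [Hist.last_snoc] at this
        simpa [cost] using this
      | cons q α =>
        have hq : (q :: α)[0]? = some q := rfl
        rw [List.head?_cons, Option.map_some, B.prob_some hq (hμ q), B.cost_some hq,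
          Option.getD_some, PMF.tsum_map_mul]
        calc ∑' β, μ q β * ((B.c q (f q) : ℝ≥0∞) + B.contCost (B.firstStrategy f hav) N
                (π.snoc ⟨some (0, f q), (q :: α).take 0 ++ β ++ (q :: α).drop (0 + 1)⟩))
            ≤ ∑' β, μ q β * (1 * (β.map x).sum + (B.c q (f q) + (α.map x).sum)) := by
              refine ENNReal.tsum_le_tsum fun β => mul_le_mul_right ?_ _
              refine (add_le_add_right (ih _) _).trans (le_of_eq ?_)
              rw [Hist.last_snoc]
              simp only [List.take_zero, List.nil_append, zero_add, List.drop_one, List.tail_cons,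
                List.map_append, List.sum_append]
              ring
          _ = ((q :: α).map x).sum := by
              -- `hx` rewrites every `x`; only the value at `q` is unfolded by `hf q`, and the last
              -- rewrite restores the others.
              rw [PMF.tsum_mul_affine, List.map_cons, List.sum_cons, hx, hf q, ← hx]
              ring
  intro q
  refine (iInf_le _ (B.firstStrategy f hav)).trans (iSup_le fun N => ?_)
  rw [eTotalN_eq_contCost]
  simpa [Hist.last, Hist.init, Hist.entry] using hcont N (Hist.init [q])

theorem cstar_eq_iSup_iterate_bellman [Finite T] [Finite A] (B : BMDP T A)
    (hA : ∀ q : T, (B.avail q).Nonempty) : B.cstar = ⨆ k : ℕ, B.bellman^[k] 0 :=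
  le_antisymm (B.cstar_le_of_bellman_eq hA B.bellman_iSup_iterate.symm)
    (iSup_le fun k => B.iterate_bellman_le_cstar hA k)

end BMDP

/-- For a BMDP in which each type has an available action, the Bellman operator `F` is monotone and
continuous on `[0,∞]^T`, the iterates of `0` increase, and the vector `c*` of optimal expected total
costs is a fixed point of `F`, lies above all the iterates of `0` and below every fixed point, and is
the limit of the iterates of `0`. -/
theorem mainTheorem4 {T A : Type*} [Finite T] [Finite A] (B : BMDP T A)
    (hA : ∀ q : T, (B.avail q).Nonempty) :
    (Monotone B.bellman ∧ Continuous B.bellman ∧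
      ∀ k : ℕ, 0 ≤ B.bellman^[k] 0 ∧ B.bellman^[k] 0 ≤ B.bellman^[k + 1] 0) ∧
    B.cstar = B.bellman B.cstar ∧
    (∀ k : ℕ, B.bellman^[k] 0 ≤ B.cstar) ∧
    (∀ c' : T → ℝ≥0∞, c' = B.bellman c' → B.cstar ≤ c') ∧
    Tendsto (fun k : ℕ => B.bellman^[k] 0) atTop (𝓝 B.cstar) := by
  refine ⟨⟨B.bellman_mono, B.bellman_continuous, fun k =>
      ⟨zero_le, B.monotone_iterate_bellman k.le_succ⟩⟩, ?_,
    B.iterate_bellman_le_cstar hA, fun c' h => B.cstar_le_of_bellman_eq hA h, ?_⟩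
  · rw [B.cstar_eq_iSup_iterate_bellman hA, B.bellman_iSup_iterate]
  · rw [B.cstar_eq_iSup_iterate_bellman hA]
    exact B.tendsto_iterate_bellman
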